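/- For a half-open dyadic interval $I\subseteq[0,1)$ (so $I=[k2^{-j},(k+1)2^{-j})$ with $j\ge 0$, $0\le k<2^j$), with left and right halves $I_l,I_r$, let $h_I=1_{I_r}-1_{I_l}$ be the $L^\infty$-normalized Haar function, and for $f\in L^1[0,1)$ let $f_I=|I|^{-1}\int_{[0,1)} f h_I$ be the Haar coefficients, so that $f=\int_{[0,1)}f+\sum_I f_I h_I$ whenever $f$ is a finite linear combination of the constant $1$ and the functions $h_I$ (we then say that $f$ has a finite Haar expansion). For a real sequence $g=\{g_I\}$ indexed by these intervals and $n\ge 0$ put $N_0(I)=|g_I|$ and $N_{n+1}(I)=\big((N_n(I_r)+N_n(I_l))^2+|g_I|^2\big)^{1/2}$, and let $\|g\|_{X^{1,2}}=\sup_{n\ge0}N_n([0,1))$. Let $$\|f\|_{L(1+\log^+)^{1/2}L[0,1]}=\inf\Big\{s>0:\int_0^1\Phi(|f(x)|/s)\,dx\le 1\Big\},\qquad \Phi(t)=t\,(1+\log^+t)^{1/2}.$$ Proposition. There is an absolute constant $C$ such that for every real function $f$ on $[0,1)$ with $\int_{[0,1)}f=0$ and with a finite Haar expansion, $$\big\|\{\langle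 f,h_I\rangle\}_I\big\|_{X^{1,2}}=\big\|\{|I|\,f_I\}_I\big\|_{X^{1,2}}\le C\,\|f\|_{L(1+\log^+)^{1/2}L[0,1]} .$$ -/

import Mathlib

open MeasureTheory Set
open scoped ENNReal NNReal

noncomputable section

/-- A half-open dyadic subinterval `[idx / 2 ^ gen, (idx + 1) / 2 ^ gen)` of `[0, 1)`. -/
structure DyadicInterval where
  gen : ℕ
  idx : ℕ
  idx_lt : idx < 2 ^ gen

namespace DyadicInterval

/-- The underlying subset of `[0, 1)`. -/
def toSet (I : DyadicInterval) : Set ℝ :=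
  Ico ((I.idx : ℝ) / 2 ^ I.gen) (((I.idx : ℝ) + 1) / 2 ^ I.gen)

/-- The length `|I|`. -/
def length (I : DyadicInterval) : ℝ := 1 / 2 ^ I.gen

/-- The interval `[0, 1)`. -/
def root : DyadicInterval := ⟨0, 0, by norm_num⟩

/-- The left half of `I`. -/
def left (I : DyadicInterval) : DyadicInterval :=
  ⟨I.gen + 1, 2 * I.idx, by have h := I.idx_lt; rw [pow_succ]; omega⟩

/-- The right half of `I`. -/
def right (I : DyadicInterval) : DyadicInterval :=
  ⟨I.gen + 1, 2 * I.idx + 1, by have h := I.idx_lt; rw [pow_succ]; omega⟩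

/-- The `L^∞`-normalized Haar function `h_I = 1_{I_r} - 1_{I_l}`. -/
def haar (I : DyadicInterval) (x : ℝ) : ℝ :=
  I.right.toSet.indicator 1 x - I.left.toSet.indicator 1 x

end DyadicInterval

/-- The `ℓ^p` norm `(a, b)_p` of a pair of real numbers, `1 ≤ p ≤ ∞` (maximum for `p = ∞`). -/
def pairNorm (p : ℝ≥0∞) (a b : ℝ) : ℝ := ‖(WithLp.toLp p (a, b) : WithLp p (ℝ × ℝ))‖

/-- The number left at `I` once the `n` generations below `I` have been folded into `I`, from
bottom to top, by replacing `g_I` with `((g_{I_r}, g_{I_l})_p, g_I)_q`. -/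
def folded (p q : ℝ≥0∞) (g : DyadicInterval → ℝ) : ℕ → DyadicInterval → ℝ
  | 0, I => |g I|
  | n + 1, I =>
      pairNorm q (pairNorm p (folded p q g n I.right) (folded p q g n I.left)) (g I)

/-- The `X^{p,q}` norm of a sequence indexed by the dyadic intervals of `[0, 1)`: the supremum over
`n` of the number obtained by folding, into `[0, 1)`, the truncation of the sequence to the
generations `0, …, n`. -/
def xNorm (p q : ℝ≥0∞) (g : DyadicInterval → ℝ) : ℝ≥0∞ :=
  ⨆ n : ℕ, ENNReal.ofReal (folded p q g n DyadicInterval.root)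

/-- The Haar coefficient `f_I = |I|⁻¹ ⟨f, h_I⟩` in `L²[0, 1)`. -/
def haarCoeff (f : ℝ → ℝ) (I : DyadicInterval) : ℝ :=
  I.length⁻¹ * ∫ x in Ico (0 : ℝ) 1, f x * I.haar x

/-- On `[0, 1)`, the function `f` is (almost everywhere) a finite linear combination of the
functions of the Haar basis, which consists of the constant `1` and of all the `h_I`. -/
def HasFiniteHaarExpansion (f : ℝ → ℝ) : Prop :=
  ∃ (c₀ : ℝ) (F : Finset DyadicInterval) (c : DyadicInterval → ℝ),
    f =ᵐ[volume.restrict (Ico (0 : ℝ) 1)] fun x => c₀ + ∑ I ∈ F, c I * I.haar x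

/-- The Young function `t (1 + log⁺ t)^{1/2}` on `[0, ∞)`. -/
def llogYoung (t : ℝ) : ℝ := t * √(1 + Real.posLog t)

/-- The Luxemburg norm of `L (1 + log⁺)^{1/2} L [0, 1)`. -/
def llogNorm (f : ℝ → ℝ) : ℝ≥0∞ :=
  ⨅ (s : ℝ) (_ : 0 < s)
    (_ : ∫⁻ x in Ico (0 : ℝ) 1, ENNReal.ofReal (llogYoung (|f x| / s)) ≤ 1), ENNReal.ofReal s

end

/-!
The `X^{1,2}` norm is linearized and the resulting linear functional is bounded by
`Exp L² – L (log L)^{1/2}` duality.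

At an interval `I` the outer `ℓ²` norm is attained by a unit vector `(c, s)`, so that
`N_{n+1}(I) = c (N_n(I_r) + N_n(I_l)) + s ⟨f, h_I⟩`. Hence `N_n(I) = ∫_I f φ`, where `φ` is built
from the bottom up by `φ ↦ s h_I + c φ_r + c φ_l` with `c² + s² = 1` (`exists_folded_eq_integral`).
The square function of such a `φ` is at most `1`, and the inequality `cosh u ≤ exp (u² / 2)` gives
inductively the subgaussian bound `∫_I exp (t φ) ≤ |I| exp (t² / 2)`
(`IsSubgaussianOn.glueHalves`), as in the Chang–Wilson–Wolff theorem.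

The family of bounds in `t` is turned into a single exponential-square bound by means of the
discrete Gaussian mixture `∑_{k ∈ ℤ} exp (k b - k²)`, which dominates `exp (b² / 4)` up to a
constant and whose integral against `φ` is at most `∑_k exp (-k² / 2)`. Young's inequality
`a |b| ≤ 4 a (1 + log⁺ a)^{1/2} + e ∑_k exp (k b - k²)` then concludes.
-/

/-! ### Halves of a dyadic interval -/

namespace DyadicInterval

lemma measurableSet_toSet (I : DyadicInterval) : MeasurableSet I.toSet := measurableSet_Ico

lemma length_pos (I : DyadicInterval) : 0 < I.length := by
  unfold length; positivity

lemma length_right (I : DyadicInterval) : I.right.length = I.length / 2 := by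
  simp only [length, right, pow_succ]; field_simp

lemma length_left (I : DyadicInterval) : I.left.length = I.length / 2 := by
  simp only [length, left, pow_succ]; field_simp

lemma volume_toSet (I : DyadicInterval) : volume I.toSet = ENNReal.ofReal I.length := by
  rw [toSet, Real.volume_Ico, length]
  congr 1
  ring

lemma root_toSet : root.toSet = Ico (0 : ℝ) 1 := by
  simp [toSet, root]

lemma length_root : root.length = 1 := by
  simp [length, root]

lemma left_toSet (I : DyadicInterval) :
    I.left.toSet = Ico ((I.idx : ℝ) / 2 ^ I.gen) ((2 * (I.idx : ℝ) + 1) / 2 ^ (I.gen + 1)) := by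
  simp only [toSet, left, pow_succ]
  push_cast
  congr 1
  field_simp

lemma right_toSet (I : DyadicInterval) :
    I.right.toSet =
      Ico ((2 * (I.idx : ℝ) + 1) / 2 ^ (I.gen + 1)) (((I.idx : ℝ) + 1) / 2 ^ I.gen) := by
  simp only [toSet, right, pow_succ]
  push_cast
  congr 1
  field_simp
  ring

lemma left_union_right (I : DyadicInterval) : I.left.toSet ∪ I.right.toSet = I.toSet := by
  rw [left_toSet, right_toSet, toSet, Ico_union_Ico_eq_Ico]
  · rw [pow_succ, div_le_div_iff₀ (by positivity) (by positivity)]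
    nlinarith [show (0 : ℝ) < 2 ^ I.gen by positivity]
  · rw [pow_succ, div_le_div_iff₀ (by positivity) (by positivity)]
    nlinarith [show (0 : ℝ) < 2 ^ I.gen by positivity]

lemma disjoint_left_right (I : DyadicInterval) : Disjoint I.left.toSet I.right.toSet := by
  rw [left_toSet, right_toSet]
  exact Ico_disjoint_Ico_same

lemma left_subset (I : DyadicInterval) : I.left.toSet ⊆ I.toSet :=
  I.left_union_right ▸ subset_union_left

lemma right_subset (I : DyadicInterval) : I.right.toSet ⊆ I.toSet :=
  I.left_union_right ▸ subset_union_right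

lemma toSet_subset_Ico (I : DyadicInterval) : I.toSet ⊆ Ico (0 : ℝ) 1 := by
  refine Ico_subset_Ico (by positivity) ?_
  rw [div_le_one (by positivity)]
  exact_mod_cast I.idx_lt

lemma measurable_haar (I : DyadicInterval) : Measurable I.haar :=
  (measurable_one.indicator I.right.measurableSet_toSet).sub
    (measurable_one.indicator I.left.measurableSet_toSet)

lemma abs_haar_le (I : DyadicInterval) (x : ℝ) : |I.haar x| ≤ 2 := by
  unfold haar
  refine (abs_sub _ _).trans ?_
  have h (s : Set ℝ) : |s.indicator (1 : ℝ → ℝ) x| ≤ 1 := by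
    by_cases hx : x ∈ s <;> simp [hx]
  linarith [h I.right.toSet, h I.left.toSet]

end DyadicInterval

open DyadicInterval

/-- The pairing `⟨f, h_I⟩` is the difference of the integrals over the two halves of `I`. -/
lemma length_mul_haarCoeff {f : ℝ → ℝ} (hf : IntegrableOn f (Ico 0 1)) (I : DyadicInterval) :
    I.length * haarCoeff f I = (∫ x in I.right.toSet, f x) - ∫ x in I.left.toSet, f x := by
  rw [haarCoeff, mul_inv_cancel_left₀ I.length_pos.ne']
  have key (J : DyadicInterval) :
      Integrable (J.toSet.indicator f) (volume.restrict (Ico (0 : ℝ) 1)) ∧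
      ∫ x in Ico (0 : ℝ) 1, J.toSet.indicator f x = ∫ x in J.toSet, f x :=
    ⟨hf.indicator J.measurableSet_toSet, by
      rw [integral_indicator J.measurableSet_toSet,
        Measure.restrict_restrict_of_subset J.toSet_subset_Ico]⟩
  rw [← (key I.right).2, ← (key I.left).2, ← integral_sub (key _).1 (key _).1]
  refine integral_congr_ae (.of_forall fun x => ?_)
  by_cases h1 : x ∈ I.right.toSet <;> by_cases h2 : x ∈ I.left.toSet <;> simp [haar, h1, h2]

lemma HasFiniteHaarExpansion.integrableOn {f : ℝ → ℝ} (h : HasFiniteHaarExpansion f) :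
    IntegrableOn f (Ico 0 1) := by
  obtain ⟨c₀, F, c, hf⟩ := h
  refine Integrable.congr ?_ hf.symm
  refine (integrable_const c₀).add (integrable_finsetSum _ fun I _ => Integrable.const_mul ?_ _)
  exact Integrable.of_bound I.measurable_haar.aestronglyMeasurable 2
    (.of_forall fun x => I.abs_haar_le x)

/-! ### Folding -/

lemma pairNorm_one (a b : ℝ) : pairNorm 1 a b = |a| + |b| :=
  WithLp.prod_norm_eq_of_L1 (WithLp.toLp 1 (a, b))

lemma pairNorm_two (a b : ℝ) : pairNorm 2 a b = √(a ^ 2 + b ^ 2) := by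
  have h := WithLp.prod_norm_eq_of_L2 (WithLp.toLp 2 (a, b))
  simp only [Real.norm_eq_abs, sq_abs] at h
  exact h

lemma folded_one_two_nonneg (g : DyadicInterval → ℝ) (n : ℕ) (I : DyadicInterval) :
    0 ≤ folded 1 2 g n I := by
  cases n with
  | zero => exact abs_nonneg _
  | succ n => rw [folded, pairNorm_two]; positivity

lemma folded_one_two_succ (g : DyadicInterval → ℝ) (n : ℕ) (I : DyadicInterval) :
    folded 1 2 g (n + 1) I
      = √((folded 1 2 g n I.right + folded 1 2 g n I.left) ^ 2 + g I ^ 2) := by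
  rw [folded, pairNorm_one, pairNorm_two, abs_of_nonneg (folded_one_two_nonneg ..),
    abs_of_nonneg (folded_one_two_nonneg ..)]

/-- The Euclidean norm of a vector of the plane is its inner product with a unit vector. -/
lemma exists_unit_sqrt_eq (a b : ℝ) :
    ∃ c s : ℝ, c ^ 2 + s ^ 2 = 1 ∧ √(a ^ 2 + b ^ 2) = c * a + s * b := by
  rcases eq_or_ne (a ^ 2 + b ^ 2) 0 with h | h
  · have ha : a = 0 := by nlinarith [sq_nonneg a, sq_nonneg b]
    have hb : b = 0 := by nlinarith [sq_nonneg a, sq_nonneg b]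
    exact ⟨1, 0, by norm_num, by simp [ha, hb]⟩
  · have h0 : 0 ≤ a ^ 2 + b ^ 2 := by positivity
    have hN : √(a ^ 2 + b ^ 2) ≠ 0 := by rwa [Ne, Real.sqrt_eq_zero h0]
    have hsq := Real.sq_sqrt h0
    refine ⟨a / √(a ^ 2 + b ^ 2), b / √(a ^ 2 + b ^ 2), ?_, ?_⟩
    · field_simp
      linarith
    · field_simp
      linarith

/-! ### Subgaussian functions on a dyadic interval -/

/-- A bounded measurable function whose exponential moments on `I`, with respect to normalized
Lebesgue measure, are at most those of a standard Gaussian variable. Outside `I` the function is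
arbitrary. -/
structure IsSubgaussianOn (I : DyadicInterval) (φ : ℝ → ℝ) : Prop where
  measurable : Measurable φ
  bounded : ∃ B, ∀ x, |φ x| ≤ B
  lintegral_exp_le (t : ℝ) :
    ∫⁻ x in I.toSet, ENNReal.ofReal (Real.exp (t * φ x))
      ≤ ENNReal.ofReal (I.length * Real.exp (t ^ 2 / 2))

lemma isSubgaussianOn_zero (I : DyadicInterval) : IsSubgaussianOn I 0 where
  measurable := measurable_zero
  bounded := ⟨0, by simp⟩
  lintegral_exp_le t := by
    simp only [Pi.zero_apply, mul_zero, Real.exp_zero, ENNReal.ofReal_one, lintegral_const,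
      one_mul, Measure.restrict_apply_univ, volume_toSet]
    exact ENNReal.ofReal_le_ofReal
      (le_mul_of_one_le_right I.length_pos.le (Real.one_le_exp (by positivity)))

/-- The function `s h_I + c φ_r` on `I_r`, `s h_I + c φ_l` on `I_l`, and `0` elsewhere. -/
noncomputable def glueHalves (I : DyadicInterval) (c s : ℝ) (φr φl : ℝ → ℝ) (x : ℝ) : ℝ :=
  I.right.toSet.indicator (fun x => s + c * φr x) x +
    I.left.toSet.indicator (fun x => -s + c * φl x) x

lemma glueHalves_of_mem_right {I : DyadicInterval} {c s : ℝ} {φr φl : ℝ → ℝ} {x : ℝ}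
    (hx : x ∈ I.right.toSet) : glueHalves I c s φr φl x = s + c * φr x := by
  simp [glueHalves, hx, I.disjoint_left_right.notMem_of_mem_right hx]

lemma glueHalves_of_mem_left {I : DyadicInterval} {c s : ℝ} {φr φl : ℝ → ℝ} {x : ℝ}
    (hx : x ∈ I.left.toSet) : glueHalves I c s φr φl x = -s + c * φl x := by
  simp [glueHalves, hx, I.disjoint_left_right.notMem_of_mem_left hx]

/-- The inductive step of the Chang–Wilson–Wolff argument: the two halves contribute the factors
`exp (± t s)`, whose average is `cosh (t s) ≤ exp (t² s² / 2)`, and this is exactly what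
`c² + s² = 1` leaves room for. -/
lemma IsSubgaussianOn.glueHalves {I : DyadicInterval} {φr φl : ℝ → ℝ}
    (hr : IsSubgaussianOn I.right φr) (hl : IsSubgaussianOn I.left φl) {c s : ℝ}
    (hcs : c ^ 2 + s ^ 2 = 1) : IsSubgaussianOn I (glueHalves I c s φr φl) where
  measurable :=
    ((measurable_const.add (hr.measurable.const_mul c)).indicator
      I.right.measurableSet_toSet).add
    ((measurable_const.add (hl.measurable.const_mul c)).indicator I.left.measurableSet_toSet)
  bounded := by
    obtain ⟨Br, hBr⟩ := hr.bounded
    obtain ⟨Bl, hBl⟩ := hl.bounded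
    have aux (S : Set ℝ) (u : ℝ) (φ : ℝ → ℝ) (B : ℝ) (hB : ∀ x, |φ x| ≤ B) (x : ℝ) :
        |S.indicator (fun x => u + c * φ x) x| ≤ |u| + |c| * B := by
      refine (norm_indicator_le_norm_self (fun x => u + c * φ x) x).trans ?_
      refine (abs_add_le _ _).trans ?_
      rw [abs_mul]
      gcongr
      exact hB x
    exact ⟨_, fun x =>
      (abs_add_le _ _).trans (add_le_add (aux _ s _ _ hBr x) (aux _ (-s) _ _ hBl x))⟩
  lintegral_exp_le t := by
    have half (J : DyadicInterval) (hJ : J.length = I.length / 2) (u : ℝ) (φ : ℝ → ℝ)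
        (hφ : IsSubgaussianOn J φ)
        (hu : ∀ x ∈ J.toSet, _root_.glueHalves I c s φr φl x = u + c * φ x) :
        ∫⁻ x in J.toSet, ENNReal.ofReal (Real.exp (t * _root_.glueHalves I c s φr φl x))
          ≤ ENNReal.ofReal
            (Real.exp (t * u) * (I.length / 2 * Real.exp ((t * c) ^ 2 / 2))) := by
      calc ∫⁻ x in J.toSet, ENNReal.ofReal (Real.exp (t * _root_.glueHalves I c s φr φl x))
          = ∫⁻ x in J.toSet, ENNReal.ofReal (Real.exp (t * u)) *
              ENNReal.ofReal (Real.exp (t * c * φ x)) := by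
            refine setLIntegral_congr_fun J.measurableSet_toSet fun x hx => ?_
            rw [hu x hx, ← ENNReal.ofReal_mul (Real.exp_pos _).le, ← Real.exp_add]
            congr 2
            ring
        _ = ENNReal.ofReal (Real.exp (t * u)) *
              ∫⁻ x in J.toSet, ENNReal.ofReal (Real.exp (t * c * φ x)) :=
            lintegral_const_mul' _ _ ENNReal.ofReal_ne_top
        _ ≤ ENNReal.ofReal (Real.exp (t * u)) *
              ENNReal.ofReal (J.length * Real.exp ((t * c) ^ 2 / 2)) := by
            gcongr
            exact hφ.lintegral_exp_le _
        _ = _ := by rw [hJ, ← ENNReal.ofReal_mul (Real.exp_pos _).le]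
    rw [← I.left_union_right,
      lintegral_union I.right.measurableSet_toSet I.disjoint_left_right]
    refine (add_le_add
      (half I.left I.length_left (-s) φl hl fun x hx => glueHalves_of_mem_left hx)
      (half I.right I.length_right s φr hr fun x hx => glueHalves_of_mem_right hx)).trans ?_
    have hL := I.length_pos
    rw [← ENNReal.ofReal_add (by positivity) (by positivity)]
    refine ENNReal.ofReal_le_ofReal ?_
    calc Real.exp (t * -s) * (I.length / 2 * Real.exp ((t * c) ^ 2 / 2)) +
          Real.exp (t * s) * (I.length / 2 * Real.exp ((t * c) ^ 2 / 2))
        = I.length * Real.cosh (t * s) * Real.exp ((t * c) ^ 2 / 2) := by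
          rw [Real.cosh_eq, mul_neg]; ring
      _ ≤ I.length * Real.exp ((t * s) ^ 2 / 2) * Real.exp ((t * c) ^ 2 / 2) := by
          gcongr
          exact Real.cosh_le_exp_half_sq _
      _ = I.length * Real.exp (t ^ 2 / 2) := by
          rw [mul_assoc, ← Real.exp_add]
          congr 2
          linear_combination t ^ 2 / 2 * hcs

lemma IsSubgaussianOn.integrableOn_mul {I : DyadicInterval} {φ f : ℝ → ℝ}
    (hφ : IsSubgaussianOn I φ) {S : Set ℝ} (hf : IntegrableOn f S) :
    IntegrableOn (fun x => f x * φ x) S := by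
  obtain ⟨B, hB⟩ := hφ.bounded
  exact hf.mul_bdd (c := B) hφ.measurable.aestronglyMeasurable (.of_forall hB)

lemma integral_mul_glueHalves {f : ℝ → ℝ} (hf : IntegrableOn f (Ico 0 1)) {I : DyadicInterval}
    {φr φl : ℝ → ℝ} (hr : IsSubgaussianOn I.right φr) (hl : IsSubgaussianOn I.left φl) {c s : ℝ}
    (hcs : c ^ 2 + s ^ 2 = 1) :
    ∫ x in I.toSet, f x * glueHalves I c s φr φl x =
      c * ((∫ x in I.right.toSet, f x * φr x) + ∫ x in I.left.toSet, f x * φl x) +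
        s * ((∫ x in I.right.toSet, f x) - ∫ x in I.left.toSet, f x) := by
  have half (J : DyadicInterval) (u : ℝ) (φ : ℝ → ℝ) (hφ : IsSubgaussianOn J φ)
      (hu : ∀ x ∈ J.toSet, glueHalves I c s φr φl x = u + c * φ x) :
      ∫ x in J.toSet, f x * glueHalves I c s φr φl x =
        u * (∫ x in J.toSet, f x) + c * ∫ x in J.toSet, f x * φ x := by
    have hfJ : IntegrableOn f J.toSet := hf.mono_set J.toSet_subset_Ico
    rw [← integral_const_mul, ← integral_const_mul,
      ← integral_add (hfJ.const_mul u) ((hφ.integrableOn_mul hfJ).const_mul c)]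
    refine setIntegral_congr_fun J.measurableSet_toSet fun x hx => ?_
    rw [hu x hx]
    ring
  have hint := (hr.glueHalves hl hcs).integrableOn_mul (hf.mono_set I.toSet_subset_Ico)
  rw [← I.left_union_right, setIntegral_union I.disjoint_left_right I.right.measurableSet_toSet
      (hint.mono_set I.left_subset) (hint.mono_set I.right_subset),
    half I.left (-s) φl hl fun x hx => glueHalves_of_mem_left hx,
    half I.right s φr hr fun x hx => glueHalves_of_mem_right hx]
  ring

/-- Each folded number is attained as the pairing of `f` with a subgaussian function. -/
lemma exists_folded_eq_integral {f : ℝ → ℝ} (hf : IntegrableOn f (Ico 0 1)) (n : ℕ)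
    (I : DyadicInterval) :
    ∃ φ, IsSubgaussianOn I φ ∧
      folded 1 2 (fun J => J.length * haarCoeff f J) n I = ∫ x in I.toSet, f x * φ x := by
  have step (J : DyadicInterval) (φr φl : ℝ → ℝ) (hr : IsSubgaussianOn J.right φr)
      (hl : IsSubgaussianOn J.left φl) :
      ∃ φ, IsSubgaussianOn J φ ∧
        √(((∫ x in J.right.toSet, f x * φr x) + ∫ x in J.left.toSet, f x * φl x) ^ 2 +
          (J.length * haarCoeff f J) ^ 2) = ∫ x in J.toSet, f x * φ x := by
    obtain ⟨c, s, hcs, h⟩ := exists_unit_sqrt_eq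
      ((∫ x in J.right.toSet, f x * φr x) + ∫ x in J.left.toSet, f x * φl x)
      (J.length * haarCoeff f J)
    refine ⟨_, hr.glueHalves hl hcs, ?_⟩
    rw [h, integral_mul_glueHalves hf hr hl hcs, length_mul_haarCoeff hf]
  induction n generalizing I with
  | zero =>
    obtain ⟨φ, hφ, h⟩ := step I 0 0 (isSubgaussianOn_zero _) (isSubgaussianOn_zero _)
    refine ⟨φ, hφ, h ▸ ?_⟩
    simp [folded, Real.sqrt_sq_eq_abs]
  | succ n ih =>
    obtain ⟨φr, hr, hr'⟩ := ih I.right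
    obtain ⟨φl, hl, hl'⟩ := ih I.left
    obtain ⟨φ, hφ, h⟩ := step I φr φl hr hl
    exact ⟨φ, hφ, by rw [folded_one_two_succ, hr', hl', h]⟩

/-! ### Exponential-square integrability and Young's inequality -/

/-- The discrete Gaussian mixture `∑_{k ∈ ℤ} exp (k b - k²)` of exponentials, which is comparable
to `exp (b² / 4)`. -/
noncomputable def expMixture (b : ℝ) : ℝ≥0∞ :=
  ∑' k : ℤ, ENNReal.ofReal (Real.exp (k * b - (k : ℝ) ^ 2))

lemma ofReal_exp_sq_le_expMixture (b : ℝ) :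
    ENNReal.ofReal (Real.exp (b ^ 2 / 4)) ≤ ENNReal.ofReal (Real.exp 1) * expMixture b := by
  -- Among the terms of the sum, the one with `k` nearest to the maximizer `b / 2` suffices.
  refine le_trans ?_ (mul_le_mul_right (ENNReal.le_tsum ⌊b / 2⌋) _)
  rw [← ENNReal.ofReal_mul (Real.exp_pos _).le, ← Real.exp_add]
  refine ENNReal.ofReal_le_ofReal (Real.exp_le_exp.2 ?_)
  nlinarith [Int.floor_le (b / 2), Int.lt_floor_add_one (b / 2)]

lemma tsum_exp_neg_sq_ne_top : ∑' k : ℤ, ENNReal.ofReal (Real.exp (-(k : ℝ) ^ 2 / 2)) ≠ ∞ := by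
  refine Summable.tsum_ofReal_ne_top ?_
  have h : Summable fun n : ℕ => Real.exp (-(n : ℝ) ^ 2 / 2) := by
    refine Summable.of_nonneg_of_le (fun _ => (Real.exp_pos _).le) (fun n => ?_)
      (Real.summable_exp_neg_nat.mul_left (Real.exp 1))
    rw [← Real.exp_add]
    exact Real.exp_le_exp.2 (by nlinarith [sq_nonneg ((n : ℝ) - 1)])
  exact Summable.of_nat_of_neg (by simpa using h) (by simpa using h)

lemma IsSubgaussianOn.lintegral_expMixture_le {φ : ℝ → ℝ} (h : IsSubgaussianOn root φ) :
    ∫⁻ x in Ico (0 : ℝ) 1, expMixture (φ x)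
      ≤ ∑' k : ℤ, ENNReal.ofReal (Real.exp (-(k : ℝ) ^ 2 / 2)) := by
  have hm := h.measurable
  unfold expMixture
  rw [lintegral_tsum fun k => by fun_prop]
  refine ENNReal.tsum_le_tsum fun k => ?_
  have hexp := h.lintegral_exp_le k
  rw [root_toSet, length_root, one_mul] at hexp
  calc ∫⁻ x in Ico (0 : ℝ) 1, ENNReal.ofReal (Real.exp (k * φ x - (k : ℝ) ^ 2))
      = ∫⁻ x in Ico (0 : ℝ) 1, ENNReal.ofReal (Real.exp (-(k : ℝ) ^ 2)) *
          ENNReal.ofReal (Real.exp (k * φ x)) := by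
        refine lintegral_congr fun x => ?_
        rw [← ENNReal.ofReal_mul (Real.exp_pos _).le, ← Real.exp_add]
        congr 2
        ring
    _ = ENNReal.ofReal (Real.exp (-(k : ℝ) ^ 2)) *
          ∫⁻ x in Ico (0 : ℝ) 1, ENNReal.ofReal (Real.exp (k * φ x)) :=
        lintegral_const_mul' _ _ ENNReal.ofReal_ne_top
    _ ≤ ENNReal.ofReal (Real.exp (-(k : ℝ) ^ 2)) *
          ENNReal.ofReal (Real.exp ((k : ℝ) ^ 2 / 2)) := by gcongr
    _ = ENNReal.ofReal (Real.exp (-(k : ℝ) ^ 2 / 2)) := by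
        rw [← ENNReal.ofReal_mul (Real.exp_pos _).le, ← Real.exp_add]
        congr 2
        ring

lemma llogYoung_nonneg {a : ℝ} (ha : 0 ≤ a) : 0 ≤ llogYoung a :=
  mul_nonneg ha (Real.sqrt_nonneg _)

/-- Young's inequality for the complementary pair `t (1 + log⁺ t)^{1/2}`, `exp (t²)`. -/
lemma mul_le_llogYoung_add_exp_sq {a b : ℝ} (ha : 0 ≤ a) (hb : 0 ≤ b) :
    a * b ≤ 4 * llogYoung a + Real.exp (b ^ 2 / 4) := by
  have h0 : 0 ≤ 1 + Real.posLog a := add_nonneg zero_le_one Real.posLog_nonneg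
  rcases le_total b (4 * √(1 + Real.posLog a)) with h | h
  · have := mul_le_mul_of_nonneg_left h ha
    have h2 := Real.exp_pos (b ^ 2 / 4)
    unfold llogYoung
    linarith
  ·
    -- Here `b` is so large compared with `a` that `a ≤ exp (b² / 16 - 1)`.
    have h1 : 1 + Real.posLog a ≤ b ^ 2 / 16 := by
      have := pow_le_pow_left₀ (by positivity) h 2
      rw [mul_pow, Real.sq_sqrt h0] at this
      linarith
    have h2 : a ≤ Real.exp (b ^ 2 / 16 - 1) := by
      rcases ha.eq_or_lt with rfl | hpos
      · exact (Real.exp_pos _).le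
      · rw [← Real.log_le_iff_le_exp hpos]
        have : Real.log a ≤ Real.posLog a := le_max_right _ _
        linarith
    have h3 : b ≤ Real.exp (b ^ 2 * (3 / 16) + 1) := by
      have := Real.add_one_le_exp (b ^ 2 * (3 / 16) + 1)
      nlinarith [sq_nonneg (b - 8 / 3)]
    have h4 : a * b ≤ Real.exp (b ^ 2 / 4) := by
      calc a * b ≤ Real.exp (b ^ 2 / 16 - 1) * Real.exp (b ^ 2 * (3 / 16) + 1) := by gcongr
        _ = Real.exp (b ^ 2 / 4) := by rw [← Real.exp_add]; congr 1; ring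
    linarith [llogYoung_nonneg ha]

lemma ofReal_mul_abs_le {a : ℝ} (ha : 0 ≤ a) (b : ℝ) :
    ENNReal.ofReal (a * |b|)
      ≤ 4 * ENNReal.ofReal (llogYoung a) + ENNReal.ofReal (Real.exp 1) * expMixture b := by
  calc ENNReal.ofReal (a * |b|)
      ≤ ENNReal.ofReal (4 * llogYoung a + Real.exp (b ^ 2 / 4)) := by
        refine ENNReal.ofReal_le_ofReal ?_
        simpa using mul_le_llogYoung_add_exp_sq ha (abs_nonneg b)
    _ = 4 * ENNReal.ofReal (llogYoung a) + ENNReal.ofReal (Real.exp (b ^ 2 / 4)) := by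
        rw [ENNReal.ofReal_add (by linarith [llogYoung_nonneg ha]) (Real.exp_pos _).le,
          ENNReal.ofReal_mul (by norm_num)]
        norm_num
    _ ≤ _ := by
        gcongr
        exact ofReal_exp_sq_le_expMixture b

/-- The constant `4 + e ∑_{k ∈ ℤ} exp (-k² / 2)`. -/
noncomputable def foldingConst : ℝ≥0∞ :=
  4 + ENNReal.ofReal (Real.exp 1) * ∑' k : ℤ, ENNReal.ofReal (Real.exp (-(k : ℝ) ^ 2 / 2))

lemma foldingConst_ne_top : foldingConst ≠ ∞ :=
  ENNReal.add_ne_top.2 ⟨by norm_num, ENNReal.mul_ne_top ENNReal.ofReal_ne_top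
    tsum_exp_neg_sq_ne_top⟩

lemma foldingConst_ne_zero : foldingConst ≠ 0 := by
  simp [foldingConst]

lemma IsSubgaussianOn.ofReal_integral_mul_le {f φ : ℝ → ℝ} (hf : IntegrableOn f (Ico 0 1))
    (hφ : IsSubgaussianOn root φ) {s : ℝ} (hs : 0 < s)
    (h : ∫⁻ x in Ico (0 : ℝ) 1, ENNReal.ofReal (llogYoung (|f x| / s)) ≤ 1) :
    ENNReal.ofReal (∫ x in Ico (0 : ℝ) 1, f x * φ x) ≤ foldingConst * ENNReal.ofReal s := by
  have hfm : AEMeasurable f (volume.restrict (Ico (0 : ℝ) 1)) := hf.aemeasurable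
  have hmeas : AEMeasurable (fun x => 4 * ENNReal.ofReal (llogYoung (|f x| / s)))
      (volume.restrict (Ico (0 : ℝ) 1)) := by
    unfold llogYoung
    have hlog : Measurable Real.posLog := Real.continuous_posLog.measurable
    have habs : AEMeasurable (fun x => |f x| / s) (volume.restrict (Ico (0 : ℝ) 1)) :=
      hfm.abs.div_const s
    have hlog' := hlog.comp_aemeasurable habs
    exact ((habs.mul (hlog'.const_add 1).sqrt).ennreal_ofReal).const_mul 4
  calc ENNReal.ofReal (∫ x in Ico (0 : ℝ) 1, f x * φ x)
      ≤ ‖∫ x in Ico (0 : ℝ) 1, f x * φ x‖ₑ := Real.ofReal_le_enorm _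
    _ ≤ ∫⁻ x in Ico (0 : ℝ) 1, ‖f x * φ x‖ₑ := enorm_integral_le_lintegral_enorm _
    _ = ∫⁻ x in Ico (0 : ℝ) 1, ENNReal.ofReal s * ENNReal.ofReal (|f x| / s * |φ x|) := by
        refine lintegral_congr fun x => ?_
        rw [← ENNReal.ofReal_mul hs.le, Real.enorm_eq_ofReal_abs, abs_mul]
        congr 1
        field_simp
    _ = ENNReal.ofReal s * ∫⁻ x in Ico (0 : ℝ) 1, ENNReal.ofReal (|f x| / s * |φ x|) :=
        lintegral_const_mul' _ _ ENNReal.ofReal_ne_top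
    _ ≤ ENNReal.ofReal s * ∫⁻ x in Ico (0 : ℝ) 1,
          (4 * ENNReal.ofReal (llogYoung (|f x| / s)) +
            ENNReal.ofReal (Real.exp 1) * expMixture (φ x)) := by
        gcongr with x
        exact ofReal_mul_abs_le (by positivity) _
    _ = ENNReal.ofReal s * (4 * (∫⁻ x in Ico (0 : ℝ) 1, ENNReal.ofReal (llogYoung (|f x| / s))) +
          ENNReal.ofReal (Real.exp 1) * ∫⁻ x in Ico (0 : ℝ) 1, expMixture (φ x)) := by
        rw [lintegral_add_left' hmeas, lintegral_const_mul' _ _ (by norm_num),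
          lintegral_const_mul' _ _ ENNReal.ofReal_ne_top]
    _ ≤ ENNReal.ofReal s * (4 * 1 + ENNReal.ofReal (Real.exp 1) *
          ∑' k : ℤ, ENNReal.ofReal (Real.exp (-(k : ℝ) ^ 2 / 2))) := by
        gcongr
        exact hφ.lintegral_expMixture_le
    _ = foldingConst * ENNReal.ofReal s := by rw [foldingConst, mul_one, mul_comm]

/-! ### The estimate -/

theorem mainTheorem8 :
    ∃ C : ℝ≥0, ∀ f : ℝ → ℝ, HasFiniteHaarExpansion f →
      ∫ x in Ico (0 : ℝ) 1, f x = 0 →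
      xNorm 1 2 (fun I => I.length * haarCoeff f I) ≤ (C : ℝ≥0∞) * llogNorm f := by
  refine ⟨foldingConst.toNNReal, fun f hf _ => ?_⟩
  rw [ENNReal.coe_toNNReal foldingConst_ne_top, xNorm, llogNorm]
  refine iSup_le fun n => ?_
  obtain ⟨φ, hφ, hn⟩ := exists_folded_eq_integral hf.integrableOn n root
  rw [root_toSet] at hn
  simp only [hn, ENNReal.mul_iInf_of_ne foldingConst_ne_zero foldingConst_ne_top]
  exact le_iInf fun s => le_iInf fun hs => le_iInf fun h =>
    hφ.ofReal_integral_mul_le hf.integrableOn hs h
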